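/- **Model.** A *context* $\gamma$ consists of: a directed graph on a set $\mathbb I$ of agents, without loops, with edge set $N$ and delivery bounds $b(i,j)\in(0,\infty]$ on the edges (finite bounds are integral in discrete time, real in continuous time); a set of local states $S_i$ for each agent; a set of messages; a set of external inputs, each observed by one agent; and whether or not the agents have a shared clock. The set of times is $\mathbb T=\mathbb N\cup\{0\}$ (discrete time) or $\mathbb T=\mathbb R_{\ge 0}$ (continuous time). A *protocol* $P$ assigns to each agent a set of initial states and a deterministic action function which, from the state of the agent just before time $t$ and what it observes at $t$ (external inputs, delivered messages with their senders, and, in continuous time, timer rings; also $t$ itself if there is a shared clock), determines its new state, a set of messages sent to out-neighbours, whether it responds, and, in continuous time, an optional timer. A *run* of $P$ assigns to each time the set of events taking place and the agents' states, these being governed by $P$, such that every external input occurs at most once, every message sent at $t$ by $i$ to $j$ is delivered exactly once, at some time $t'\in\mathbb T$ with $t<t'\le t+b(i,j)$, and only sent messages are delivered. In discrete time $R_\gamma(P)$ is the set of all runs of $P$, where every agent acts at every time. In continuous time an agent acts exactly when it is enabled, i.e. at time $0$ and at every supremum of a nonempty set of times at which it observes events; its state just before $t>0$ is a given pseudo-limit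 of its earlier states (a function of their germ to the left of $t$, which takes the expected value at constant germs), and its state stays equal to that if it is not enabled at $t$; a timer set at $t'$ for $t$ rings iff the agent is not enabled strictly between $t'$ and $t$; and the context comes with a set $R_\gamma(P)$ of runs for each $P$, such that for all $r\in R_\gamma(P)$, $t,d\in\mathbb T$ and $i\in\mathbb I$: * (determinism) if $r'\in R_\gamma(P)$ has the same initial state of $i$, and $i$ observes the same external inputs and deliveries at the same times up to and including $t$ in $r$ and $r'$, then the state of $i$ at $t$ is the same in both; * (no foresight) some $r'\in R_\gamma(P)$ agrees with $r$ up to and including $t$ (including the initial states), has no external input after $t$, and every early delivery after $t$ in $r'$ takes place at least $d$ after the message is sent; * (no extrasensory perception) some $r'\in R_\gamma(P)$ with the same initial states as $r$ is such that the ND events in $r'$ up to time $t$ are exactly the ND events $e$ in $r$ with $e\rightsquigarrow_r(i,t)$ (defined next), with the same occurrence times. An event is *non-deterministic* (ND) if it is an external input or an early delivery, i.e. a delivery at time $t'<t+b(i,j)$ of a message sent at $t$ from $i$ to $j$. *Syncausality* $\rightsquigarrow_r$ is the reflexive-transitive relation on $\mathbb I\times\mathbb T$ generated by $(i,t)\rightsquigarrow_r(i,t')$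 for $t\le t'$; $(i,t)\rightsquigarrow_r(j,t')$ if a message sent in $r$ by $i$ at $t$ is delivered to $j$ at $t'$; and $(i,t)\rightsquigarrow_r(j,t+b(i,j))$ if $(i,j)\in N$ and $b(i,j)<\infty$. A *syncausal path* is a finite chain of such steps, and $e\rightsquigarrow_r(i,t)$ means $(i_e,t_e)\rightsquigarrow_r(i,t)$, where $i_e$ observes $e$, at time $t_e$. The context $\gamma$ is a *bounded-syncausal-path context* if for all $P$, all $r\in R_\gamma(P)$ and all $\theta\rightsquigarrow_r\theta'$, the number of ND events along a syncausal path from $\theta$ to $\theta'$ (the early deliveries that it uses) is bounded. Put $\Omega=R_\gamma(P)\times\mathbb T$ and let $\psi\subseteq\Omega$. Write $K_i(\psi)$ for the set of points $p\in\Omega$ such that every $q\in\Omega$ at which $i$ has the same state as at $p$ (and, with a shared clock, which has the same time as $p$) lies in $\psi$. For $\varepsilon\in\Delta=(\mathbb T-\mathbb T)\cup\{\pm\infty\}$ let $\circledcirc^{\le\varepsilon}(\psi)=\{(r,t)\in\Omega\mid\exists t'\in\mathbb T:\ t'\le t+\varepsilon,\ (r,t')\in\psi\}$. For $I\subseteq\mathbb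 I$ and $\delta$ a function from the ordered pairs of distinct elements of $I$ to $\Delta$, the *$\delta$-common knowledge* $C_I^\delta(\psi)=(C_I^\delta(\psi)_i)_{i\in I}$ is the greatest fixed point of $$(x_i)_{i\in I}\ \mapsto\ \Big(\bigcap_{j\in I\setminus\{i\}}\circledcirc^{\le\delta(i,j)}\big(K_j(\psi\cap x_j)\big)\Big)_{i\in I}$$ on $I$-tuples of subsets of $\Omega$, ordered by coordinatewise inclusion. Let $G_\delta$ be the directed graph on $I$ whose edges are the pairs $(i,j)$, $i\ne j$, with $\delta(i,j)\neq\infty$. **Statement.** In discrete as well as in continuous time: let $\gamma$ be a bounded-syncausal-path context with $b(i,j)=\infty$ for every $(i,j)\in N$, let $I\subseteq\mathbb I$, let $\delta$ be a function from the ordered pairs of distinct elements of $I$ to $\Delta$, and let $\tilde e$ be an ND event (identified with the set of points at which it is occurring). If $G_\delta$ has a strongly connected component with more than one vertex, then for every protocol $P$, $$C_I^\delta\big(\circledcirc^{\le 0}(\tilde e)\big)=(\emptyset)_{i\in I}\quad\text{in } \Omega=R_\gamma(P)\times\mathbb T.$$ -/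

import Mathlib

open scoped NNReal

universe u

namespace TimelyCoordination

/-! ### Contexts, events and runs -/

/-- A context over the set of times `T`: a weighted directed graph of agents, the local states,
the messages and the external inputs. The weight `bound i j` (which matters only if
`(i, j)` is an edge) is the longest possible delivery time of a message from `i` to `j`;
the value `⊤` means that there is no bound. `sharedClock` says whether the agents
have access to the current time. -/
structure Context (T : Type) [LinearOrder T] [AddCommMonoid T] where
  Agent : Type u
  Nbr : Agent → Agent → Prop
  nbr_irrefl : ∀ i, ¬ Nbr i i
  bound : Agent → Agent → WithTop T
  bound_pos : ∀ i j, Nbr i j → 0 < bound i j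
  State : Agent → Type u
  Msg : Type u
  ExtInput : Type u
  inputObserver : ExtInput → Agent
  sharedClock : Prop

section Generic

variable {T : Type} [LinearOrder T] [AddCommMonoid T]

/-- The delivery `(m, t', (i, j))` of a message `m` that `i` sent at time `t'` to `j`. -/
structure Delivery (γ : Context.{u} T) where
  msg : γ.Msg
  sentAt : T
  sender : γ.Agent
  recipient : γ.Agent
  nbr : γ.Nbr sender recipient

/-- The events. Timer rings happen only in the continuous-time model. -/
inductive Event (γ : Context.{u} T) where
  | external (e : γ.ExtInput)
  | delivery (d : Delivery γ)
  | timer (i : γ.Agent)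

/-- The agent that observes an event. -/
def Event.observer {γ : Context.{u} T} : Event γ → γ.Agent
  | .external e => γ.inputObserver e
  | .delivery d => d.recipient
  | .timer i => i

/-- A history: the initial states used, and, for each time, the set of events that take place
and the state of each agent. -/
structure Run (γ : Context.{u} T) where
  init : (i : γ.Agent) → γ.State i
  env : T → Set (Event γ)
  state : T → (i : γ.Agent) → γ.State i

/-- What an agent acts upon at a given time, besides its state: the external inputs that it
observes, the messages delivered to it (each with its sender), and whether its timer rings. -/
structure Observation (γ : Context.{u} T) (i : γ.Agent) where
  inputs : Set {e : γ.ExtInput // γ.inputObserver e = i}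
  messages : Set (γ.Msg × γ.Agent)
  ring : Prop

/-- What an agent does at a given time: set a new state, send messages to neighbours, possibly
respond, and possibly set a timer to ring after a given delay (timers are used only in the
continuous-time model; in discrete time this component has no effect). -/
structure Action (γ : Context.{u} T) (i : γ.Agent) where
  newState : γ.State i
  send : Set (γ.Msg × {j : γ.Agent // γ.Nbr i j})
  respond : Bool
  setTimer : Option T

/-- A (joint, deterministic) protocol. Only if there is a shared clock may the action depend
on the time. -/
structure Protocol (γ : Context.{u} T) where
  initial : (i : γ.Agent) → Set (γ.State i)
  act : (i : γ.Agent) → γ.State i → Observation γ i → T → Action γ i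
  act_eq : ¬ γ.sharedClock → ∀ i s o t t', act i s o t = act i s o t'

/-- The observation of `i` at `t`. -/
def Run.observation {γ : Context.{u} T} (r : Run γ) (i : γ.Agent) (t : T) : Observation γ i where
  inputs := {e | Event.external e.1 ∈ r.env t}
  messages := {p | ∃ d : Delivery γ, Event.delivery d ∈ r.env t ∧ d.recipient = i ∧
    d.msg = p.1 ∧ d.sender = p.2}
  ring := Event.timer i ∈ r.env t

/-- The laws that external inputs and deliveries obey in a history, where `sent i t m j` says
that `i` sends `m` to `j` at `t`: an external input occurs at most once; a message is
delivered exactly once, after it is sent and within its bound; only sent messages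
are delivered. -/
structure EnvironmentLaws {γ : Context.{u} T} (r : Run γ)
    (sent : (i : γ.Agent) → T → γ.Msg → {j : γ.Agent // γ.Nbr i j} → Prop) : Prop where
  external_once : ∀ e t t', Event.external e ∈ r.env t → Event.external e ∈ r.env t' → t = t'
  delivered : ∀ d : Delivery γ, sent d.sender d.sentAt d.msg ⟨d.recipient, d.nbr⟩ →
    ∃ t', d.sentAt < t' ∧ (t' : WithTop T) ≤ d.sentAt + γ.bound d.sender d.recipient ∧
      ∀ t'', Event.delivery d ∈ r.env t'' ↔ t'' = t'
  only_sent : ∀ (d : Delivery γ) t', Event.delivery d ∈ r.env t' →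
    sent d.sender d.sentAt d.msg ⟨d.recipient, d.nbr⟩

/-- `IsND e t`: the event `e`, when it occurs at `t`, is non-deterministic, i.e. it is an external
input or an early delivery. -/
def IsND {γ : Context.{u} T} : Event γ → T → Prop
  | .external _, _ => True
  | .delivery d, t => (t : WithTop T) < d.sentAt + γ.bound d.sender d.recipient
  | .timer _, _ => False

/-- The ND events of `r` up to and including time `t`, each with its occurrence time. -/
def Run.ND {γ : Context.{u} T} (r : Run γ) (t : T) : Set (Event γ × T) :=
  {p | p.1 ∈ r.env p.2 ∧ IsND p.1 p.2 ∧ p.2 ≤ t}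

/-! ### Syncausality -/

/-- `SyncausalPath r n θ θ'`: there is a syncausal path in `r` from `θ` to `θ'`, composed of
locality steps, message deliveries and delivery guarantees, that
contains `n` ND events (early deliveries). -/
inductive SyncausalPath {γ : Context.{u} T} (r : Run γ) :
    ℕ → γ.Agent × T → γ.Agent × T → Prop
  | refl (θ) : SyncausalPath r 0 θ θ
  | locality {n θ i t t'} : SyncausalPath r n θ (i, t) → t ≤ t' → SyncausalPath r n θ (i, t')
  | earlyDelivery {n θ} (d : Delivery γ) {t'} : SyncausalPath r n θ (d.sender, d.sentAt) →
      Event.delivery d ∈ r.env t' → d.sentAt < t' → IsND (Event.delivery d) t' →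
      SyncausalPath r (n + 1) θ (d.recipient, t')
  | lateDelivery {n θ} (d : Delivery γ) {t'} : SyncausalPath r n θ (d.sender, d.sentAt) →
      Event.delivery d ∈ r.env t' → d.sentAt < t' → ¬ IsND (Event.delivery d) t' →
      SyncausalPath r n θ (d.recipient, t')
  | guarantee {n θ i t j b} : SyncausalPath r n θ (i, t) → γ.Nbr i j → γ.bound i j = (b : T) →
      SyncausalPath r n θ (j, t + b)

/-- The syncausality relation of `r`. -/
def Syncausal {γ : Context.{u} T} (r : Run γ) (θ θ' : γ.Agent × T) : Prop :=
  ∃ n, SyncausalPath r n θ θ'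

open Classical in
/-- The supremum `L_r(θ, θ')` of the number of ND events in a syncausal path from `θ` to `θ'`. -/
noncomputable def maxNDEvents {γ : Context.{u} T} (r : Run γ) (θ θ' : γ.Agent × T) : ℕ∞ :=
  if Syncausal r θ θ' then ⨆ (n : ℕ) (_ : SyncausalPath r n θ θ'), (n : ℕ∞) else ⊤

/-- The bounded-syncausal-path property of a context in which the set of runs of `P` is
`runs P`. -/
def BoundedSyncausalPath {γ : Context.{u} T} (runs : Protocol γ → Set (Run γ)) : Prop :=
  ∀ P, ∀ r ∈ runs P, ∀ θ θ', Syncausal r θ θ' → maxNDEvents r θ θ' < ⊤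

/-- All delivery bounds are infinite. -/
def UnboundedDelivery (γ : Context.{u} T) : Prop :=
  ∀ i j, γ.Nbr i j → γ.bound i j = ⊤

/-- The ND past of the agent-time pair `(i, t)` in `r`. -/
def Run.PND {γ : Context.{u} T} (r : Run γ) (i : γ.Agent) (t : T) : Set (Event γ × T) :=
  {p | p.1 ∈ r.env p.2 ∧ IsND p.1 p.2 ∧ Syncausal r (p.1.observer, p.2) (i, t)}

/-- `r'` is a `t`-subrun of `r`. -/
def IsSubrun {γ : Context.{u} T} (t : T) (r' r : Run γ) : Prop :=
  r'.init = r.init ∧ r'.ND t ⊆ r.ND t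

/-- The `t`-retainable sets of ND events of `r`, within the set of runs `R`. -/
def retainable {γ : Context.{u} T} (R : Set (Run γ)) (r : Run γ) (t : T) :
    Set (Set (Event γ × T)) :=
  {E | ∃ r' ∈ R, IsSubrun t r' r ∧ r'.ND t = E}

/-! ### Knowledge and `δ`-common knowledge -/

/-- The space of points (run-time pairs) of a set of runs. -/
abbrev Point {γ : Context.{u} T} (R : Set (Run γ)) : Type u := R × T

/-- The points that agent `i` cannot distinguish. -/
def Indist {γ : Context.{u} T} {R : Set (Run γ)} (i : γ.Agent) (p q : Point R) : Prop :=
  p.1.1.state p.2 i = q.1.1.state q.2 i ∧ (γ.sharedClock → p.2 = q.2)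

/-- The event "`i` knows `ψ`". -/
def knows {γ : Context.{u} T} {R : Set (Run γ)} (i : γ.Agent) (ψ : Set (Point R)) :
    Set (Point R) :=
  {p | ∀ q, Indist i p q → q ∈ ψ}

/-- The points at which the event `e` is occurring. -/
def occurring {γ : Context.{u} T} (R : Set (Run γ)) (e : Event γ) : Set (Point R) :=
  {p | e ∈ p.1.1.env p.2}

/-- The embedding of the set of times into the group of its (finite) differences. -/
class TimeDiff (T : Type) (D : outParam Type) where
  toDiff : T → D

/-- The set `(𝕋 - 𝕋) ∪ {-∞, ∞}` of time differences. -/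
abbrev Delta (D : Type) : Type := WithBot (WithTop D)

/-- A time, regarded as a (finite) time difference. -/
def Delta.ofTime {T D : Type} [TimeDiff T D] (t : T) : Delta D :=
  ((TimeDiff.toDiff t : WithTop D) : WithBot (WithTop D))

variable {D : Type} [TimeDiff T D] [LinearOrder D] [AddCommGroup D]

/-- `ψ` holds at some time that is at most `ε` time units from now. -/
def noLaterThan {γ : Context.{u} T} {R : Set (Run γ)} (ε : Delta D) (ψ : Set (Point R)) :
    Set (Point R) :=
  {p | ∃ t' : T, Delta.ofTime t' ≤ Delta.ofTime p.2 + ε ∧ (p.1, t') ∈ ψ}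

/-- A function `δ` from the ordered pairs of distinct elements of `I` to the time differences. -/
abbrev Constraint {α : Type u} (I : Set α) (D : Type) : Type u :=
  (i j : I) → i ≠ j → Delta D

/-- The edges of the graph `G_δ`: the pairs `(i, j)` with `δ(i, j) ≠ ∞`. -/
def Constraint.Edge {α : Type u} {I : Set α} (δ : Constraint I D) (i j : I) : Prop :=
  ∃ h : i ≠ j, δ i j h ≠ ((⊤ : WithTop D) : Delta D)

/-- `G_δ` has a strongly connected component with at least two vertices. -/
def Constraint.HasNontrivialSCC {α : Type u} {I : Set α} (δ : Constraint I D) : Prop :=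
  ∃ i j : I, i ≠ j ∧ Relation.ReflTransGen δ.Edge i j ∧ Relation.ReflTransGen δ.Edge j i

/-- The monotone function whose greatest fixed point is `δ`-common knowledge of `ψ`. -/
def deltaStep {γ : Context.{u} T} {R : Set (Run γ)} {I : Set γ.Agent} (δ : Constraint I D)
    (ψ : Set (Point R)) : (I → Set (Point R)) →o (I → Set (Point R)) where
  toFun x := fun i => ⋂ (j : I) (h : i ≠ j), noLaterThan (δ i j h) (knows j.1 (ψ ∩ x j))
  monotone' := by
    intro x y hxy i p hp
    simp only [Set.mem_iInter] at hp ⊢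
    intro j h
    obtain ⟨t', ht', hk⟩ := hp j h
    exact ⟨t', ht', fun q hq => ⟨(hk q hq).1, hxy j (hk q hq).2⟩⟩

/-- `δ`-common knowledge of `ψ` by `I`, an `I`-tuple of events. -/
def deltaCommonKnowledge {γ : Context.{u} T} {R : Set (Run γ)} {I : Set γ.Agent}
    (δ : Constraint I D) (ψ : Set (Point R)) : I → Set (Point R) :=
  OrderHom.gfp (deltaStep δ ψ)

end Generic

instance : TimeDiff ℕ ℤ := ⟨fun n => (n : ℤ)⟩

noncomputable instance : TimeDiff ℝ≥0 ℝ := ⟨fun t => (t : ℝ)⟩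

/-! ### The discrete-time model -/

/-- The state of `i` just before `t`. -/
def Run.discreteBefore {γ : Context.{u} ℕ} (r : Run γ) (i : γ.Agent) : ℕ → γ.State i
  | 0 => r.init i
  | t + 1 => r.state t i

/-- The action of `i` at `t`. -/
def Run.discreteAction {γ : Context.{u} ℕ} (r : Run γ) (P : Protocol γ) (i : γ.Agent) (t : ℕ) :
    Action γ i :=
  P.act i (r.discreteBefore i t) (r.observation i t) t

/-- `r` is a run of `P` in the discrete-time model. -/
structure IsDiscreteRun {γ : Context.{u} ℕ} (P : Protocol γ) (r : Run γ) : Prop where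
  init_mem : ∀ i, r.init i ∈ P.initial i
  state_eq : ∀ i t, r.state t i = (r.discreteAction P i t).newState
  laws : EnvironmentLaws r fun i t m j => (m, j) ∈ (r.discreteAction P i t).send
  no_timer : ∀ i t, Event.timer i ∉ r.env t

/-- The set of all runs of `P` in the discrete-time model. -/
def discreteRuns {γ : Context.{u} ℕ} (P : Protocol γ) : Set (Run γ) :=
  {r | IsDiscreteRun P r}

/-! ### The continuous-time model -/

/-- `i` is enabled at `t`: either `t = 0`, or `t` is the supremum of a set of times at each of which
`i` observed an event. -/
def Run.Enabled {γ : Context.{u} ℝ≥0} (r : Run γ) (i : γ.Agent) (t : ℝ≥0) : Prop :=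
  t = 0 ∨ ∃ A : Set ℝ≥0, A.Nonempty ∧ (∀ s ∈ A, ∃ e ∈ r.env s, e.observer = i) ∧ IsLUB A t

/-- A pseudo-limit function: it depends only on the values in a left neighbourhood of `0`, and
has the expected value at constant functions. -/
structure PseudoLimit (S : Type u) where
  lim : (Set.Ioo (-1 : ℝ) 0 → S) → S
  lim_congr : ∀ f g, (∃ ε > 0, ∀ x : Set.Ioo (-1 : ℝ) 0, -ε < x.1 → f x = g x) → lim f = lim g
  lim_const : ∀ s, lim (fun _ => s) = s

/-- The state of `i` just before `t`. (If `t < 1`, the truncation of `t + x` at `0` is immaterial,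
as the pseudo-limit depends only on `x` close to `0`.) -/
noncomputable def Run.continuousBefore {γ : Context.{u} ℝ≥0} (L : ∀ i, PseudoLimit (γ.State i))
    (r : Run γ) (i : γ.Agent) (t : ℝ≥0) : γ.State i :=
  if t = 0 then r.init i else (L i).lim fun x => r.state (Real.toNNReal (t + x.1)) i

/-- The action of `i` at `t`, if `i` is enabled at `t`. -/
noncomputable def Run.continuousAction {γ : Context.{u} ℝ≥0} (L : ∀ i, PseudoLimit (γ.State i))
    (r : Run γ) (P : Protocol γ) (i : γ.Agent) (t : ℝ≥0) : Action γ i :=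
  P.act i (r.continuousBefore L i t) (r.observation i t) t

/-- `r` obeys the laws of a run of `P` in the continuous-time model. -/
structure IsContinuousRun {γ : Context.{u} ℝ≥0} (L : ∀ i, PseudoLimit (γ.State i))
    (P : Protocol γ) (r : Run γ) : Prop where
  init_mem : ∀ i, r.init i ∈ P.initial i
  state_of_enabled : ∀ i t, r.Enabled i t → r.state t i = (r.continuousAction L P i t).newState
  state_of_not_enabled : ∀ i t, ¬ r.Enabled i t → r.state t i = r.continuousBefore L i t
  laws : EnvironmentLaws r fun i t m j =>
    r.Enabled i t ∧ (m, j) ∈ (r.continuousAction L P i t).send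
  timer : ∀ i t, Event.timer i ∈ r.env t ↔
    ∃ t' d, r.Enabled i t' ∧ (r.continuousAction L P i t').setTimer = some d ∧ t' < t ∧
      t' + d = t ∧ ∀ s, t' < s → s < t → ¬ r.Enabled i s

/-- A context of the continuous-time model. Besides the pseudo-limits, it carries, for each protocol,
the set of its runs: the environment may be subject to further constraints (such as a
least delivery time), so that not every history that obeys the laws need be a run, but the
environment is non-deterministic and the agents are deterministic. -/
structure ContinuousContext extends Context.{u} ℝ≥0 where
  pseudoLimit : ∀ i, PseudoLimit (State i)
  runs : Protocol toContext → Set (Run toContext)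
  isRun : ∀ P, ∀ r ∈ runs P, IsContinuousRun pseudoLimit P r
  /-- The state of an agent is determined by its initial state and by the external inputs and
  message deliveries that it has observed. -/
  determinate : ∀ P, ∀ r ∈ runs P, ∀ r' ∈ runs P, ∀ i t, r.init i = r'.init i →
    (∀ s ≤ t, ∀ e : Event toContext, e.observer = i → (∀ j, e ≠ .timer j) →
      (e ∈ r.env s ↔ e ∈ r'.env s)) →
    r.state t i = r'.state t i
  /-- No foresight: at any time it is possible that no external inputs are triggered
  thereafter, and that no early delivery takes place thereafter less than `d` time units
  after the message is sent. -/
  no_foresight : ∀ P, ∀ r ∈ runs P, ∀ t d : ℝ≥0, ∃ r' ∈ runs P,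
    (r'.init = r.init ∧ ∀ s ≤ t, r'.env s = r.env s ∧ r'.state s = r.state s) ∧
    (∀ s, t < s → ∀ e, Event.external e ∉ r'.env s) ∧
    (∀ s, t < s → ∀ m : Delivery toContext, Event.delivery m ∈ r'.env s →
      IsND (Event.delivery m) s → m.sentAt + d ≤ s)
  /-- No extrasensory perception: it is possible that only the ND events in the past
  of a given agent-time pair take place. -/
  no_extrasensory_perception : ∀ P, ∀ r ∈ runs P, ∀ t i, r.PND i t ∈ retainable (runs P) r t

end TimelyCoordination

namespace TimelyCoordination

/-! ### Consequences of infinite delivery bounds -/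

section Generic

variable {T : Type} [LinearOrder T] [AddCommMonoid T] {γ : Context.{u} T}

/-! Since all bounds are infinite, every event except a timer ring is ND, and syncausal paths
consist of locality steps and early deliveries. Suppose that an agent `j` in a nontrivial component
of `G_δ` knows at some point that the ND event `e` has happened and that `j`'s component of common
knowledge holds. By no extrasensory perception, all ND events so far may be assumed to lie in the
past of `j` (`exists_indist_past`). Take an edge from `j` to some `k` in the component. By no
foresight, the run can go on without new ND events up to the time at which `k` has the corresponding
knowledge; then everything outside the past of `k` can be removed.

The ND events of the resulting run are among the original ones. So a path in it from `e` to `k` with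
`n` deliveries is, up to its last ND event, a path of the original run. That event lies in the past
of `j`, and as `k ≠ j`, getting from it to `j` takes one more delivery. This induction
(`exists_long_path`) yields paths in one run, between fixed ends, with arbitrarily many deliveries,
contrary to boundedness.

The argument rests on `Determinate`, `NoForesight` and `NoExtrasensoryPerception`. In continuous
time these belong to the context. In discrete time they are proved; the last two come from
`exists_discreteRun`, which prescribes the ND events up to a given time and delays all other
deliveries. -/

theorem UnboundedDelivery.isND (hU : UnboundedDelivery γ) {e : Event γ} {s : T}
    (he : ∀ i, e ≠ .timer i) : IsND e s := by
  cases e with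
  | external e => trivial
  | delivery d =>
    change (s : WithTop T) < d.sentAt + γ.bound d.sender d.recipient
    rw [hU _ _ d.nbr, WithTop.add_top]
    exact WithTop.coe_lt_top s
  | timer i => exact absurd rfl (he i)

theorem IsND.ne_timer {e : Event γ} {s : T} (h : IsND e s) (i : γ.Agent) : e ≠ .timer i := by
  rintro rfl
  exact h

theorem UnboundedDelivery.isND_delivery (hU : UnboundedDelivery γ) (d : Delivery γ) (s : T) :
    IsND (Event.delivery d) s :=
  hU.isND fun _ h => nomatch h

theorem UnboundedDelivery.bound_ne (hU : UnboundedDelivery γ) {i j : γ.Agent} {b : T}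
    (hn : γ.Nbr i j) : γ.bound i j ≠ (b : T) := by
  rw [hU i j hn]
  exact WithTop.top_ne_coe

/-- An event that is not a timer ring occurs at most once. -/
theorem EnvironmentLaws.unique {r : Run γ}
    {sent : (i : γ.Agent) → T → γ.Msg → {j : γ.Agent // γ.Nbr i j} → Prop}
    (h : EnvironmentLaws r sent) {e : Event γ} {s s' : T} (he : ∀ i, e ≠ .timer i)
    (hs : e ∈ r.env s) (hs' : e ∈ r.env s') : s = s' := by
  cases e with
  | external e => exact h.external_once e s s' hs hs'
  | delivery d =>
    obtain ⟨t', -, -, ht⟩ := h.delivered d (h.only_sent d s hs)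
    exact ((ht s).1 hs).trans ((ht s').1 hs').symm
  | timer i => exact absurd rfl (he i)

/-! ### Syncausal paths and their transfer between runs -/

theorem SyncausalPath.trans {r : Run γ} {n m : ℕ} {θ θ' θ'' : γ.Agent × T}
    (h : SyncausalPath r n θ θ') (h' : SyncausalPath r m θ' θ'') :
    SyncausalPath r (n + m) θ θ'' := by
  induction h' with
  | refl => exact h
  | locality _ ht ih => exact .locality (ih h) ht
  | earlyDelivery d _ hd hlt hnd ih => exact .earlyDelivery d (ih h) hd hlt hnd
  | lateDelivery d _ hd hlt hnd ih => exact .lateDelivery d (ih h) hd hlt hnd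
  | guarantee _ hn hb ih => exact .guarantee (ih h) hn hb

theorem Syncausal.trans {r : Run γ} {θ θ' θ'' : γ.Agent × T} (h : Syncausal r θ θ')
    (h' : Syncausal r θ' θ'') : Syncausal r θ θ'' := by
  obtain ⟨n, h⟩ := h
  obtain ⟨m, h'⟩ := h'
  exact ⟨_, h.trans h'⟩

theorem Syncausal.of_le {r : Run γ} {i : γ.Agent} {t t' : T} (h : t ≤ t') :
    Syncausal r (i, t) (i, t') :=
  ⟨0, .locality (.refl _) h⟩

theorem SyncausalPath.time_le (hU : UnboundedDelivery γ) {r : Run γ} {n : ℕ}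
    {θ θ' : γ.Agent × T} (h : SyncausalPath r n θ θ') : θ.2 ≤ θ'.2 := by
  induction h with
  | refl => exact le_rfl
  | locality _ ht ih => exact ih.trans ht
  | earlyDelivery d _ hd hlt hnd ih => exact ih.trans hlt.le
  | lateDelivery d _ hd hlt hnd ih => exact ih.trans hlt.le
  | guarantee _ hn hb ih => exact absurd hb (hU.bound_ne hn)

theorem Run.PND_subset_ND (hU : UnboundedDelivery γ) (r : Run γ) (i : γ.Agent) (t : T) :
    r.PND i t ⊆ r.ND t := by
  rintro p ⟨h, hnd, n, hp⟩
  exact ⟨h, hnd, hp.time_le hU⟩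

/-- A syncausal path without deliveries stays with one agent. -/
theorem SyncausalPath.fst_eq_of_zero (hU : UnboundedDelivery γ) {r : Run γ} {n : ℕ}
    {θ θ' : γ.Agent × T} (h : SyncausalPath r n θ θ') (hn : n = 0) : θ.1 = θ'.1 := by
  induction h with
  | refl => rfl
  | locality _ ht ih => exact ih hn
  | earlyDelivery d _ hd hlt hnd ih => omega
  | lateDelivery d _ hd hlt hnd ih => exact absurd (hU.isND_delivery d _) hnd
  | guarantee _ hnbr hb ih => exact absurd hb (hU.bound_ne hnbr)

/-- A syncausal path is preserved if the deliveries in the past of its end are. -/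
theorem SyncausalPath.transfer (hU : UnboundedDelivery γ) {r r' : Run γ} {n : ℕ}
    {θ θ' : γ.Agent × T} (h : SyncausalPath r n θ θ')
    (hr : ∀ (d : Delivery γ) s, Event.delivery d ∈ r.env s →
      Syncausal r (d.recipient, s) θ' → Event.delivery d ∈ r'.env s) :
    SyncausalPath r' n θ θ' := by
  induction h with
  | refl => exact .refl _
  | locality _ ht ih =>
    exact .locality (ih fun d s hd hs => hr d s hd (hs.trans (.of_le ht))) ht
  | earlyDelivery d _ hd hlt hnd ih =>
    refine .earlyDelivery d (ih fun d' s hd' hs => hr d' s hd' (hs.trans ?_))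
      (hr d _ hd ⟨0, .refl _⟩) hlt hnd
    exact ⟨1, .earlyDelivery d (.refl _) hd hlt hnd⟩
  | lateDelivery d _ hd hlt hnd ih => exact absurd (hU.isND_delivery d _) hnd
  | guarantee _ hn hb ih => exact absurd hb (hU.bound_ne hn)

/-- If a syncausal path of `r'` starts at an ND event of `r` and its deliveries take place in `r`,
then it yields a path of `r` to the last of the ND events on it. -/
theorem SyncausalPath.exists_last_event (hU : UnboundedDelivery γ) {r r' : Run γ} {n : ℕ}
    {θ θ' : γ.Agent × T} {t : T} (h : SyncausalPath r' n θ θ')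
    (hθ : ∃ f ∈ r.ND t, f.1.observer = θ.1 ∧ f.2 = θ.2)
    (hr : ∀ (d : Delivery γ) s, s ≤ θ'.2 → Event.delivery d ∈ r'.env s →
      (Event.delivery d, s) ∈ r.ND t) :
    ∃ f ∈ r.ND t, f.1.observer = θ'.1 ∧ f.2 ≤ θ'.2 ∧ SyncausalPath r n θ (θ'.1, f.2) := by
  induction h with
  | refl θ =>
    obtain ⟨f, hf, h1, h2⟩ := hθ
    refine ⟨f, hf, h1, h2.le, ?_⟩
    rw [h2]
    exact .refl _
  | locality _ ht ih =>
    obtain ⟨f, hf, h1, h2, h3⟩ := ih hθ fun d s hs => hr d s (hs.trans ht)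
    exact ⟨f, hf, h1, h2.trans ht, h3⟩
  | earlyDelivery d _ hd hlt hnd ih =>
    obtain ⟨f, hf, h1, h2, h3⟩ := ih hθ fun d s hs => hr d s (hs.trans hlt.le)
    have hm := hr d _ le_rfl hd
    -- The new delivery is itself the last event; a locality step of `r` leads from the previous
    -- last event to the sending of its message.
    exact ⟨_, hm, rfl, le_rfl, .earlyDelivery d (.locality h3 h2) hm.1 hlt hnd⟩
  | lateDelivery d _ hd hlt hnd ih => exact absurd (hU.isND_delivery d _) hnd
  | guarantee _ hn hb ih => exact absurd hb (hU.bound_ne hn)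

/-- Paths with arbitrarily many deliveries make the supremum `maxNDEvents` infinite; this is where
boundedness is contradicted. -/
theorem not_syncausal_of_unbounded_paths
    {runs : Protocol γ → Set (Run γ)} (hB : BoundedSyncausalPath runs) {P : Protocol γ}
    {r : Run γ} (hr : r ∈ runs P) {θ θ' : γ.Agent × T}
    (h : ∀ n, ∃ m, n ≤ m ∧ SyncausalPath r m θ θ') : False := by
  have hs : Syncausal r θ θ' := by
    obtain ⟨m, -, hm⟩ := h 0
    exact ⟨m, hm⟩
  have hlt := hB P r hr θ θ' hs
  rw [maxNDEvents, if_pos hs] at hlt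
  refine hlt.ne (ENat.eq_top_iff_forall_ge.2 fun n => ?_)
  obtain ⟨m, hnm, hm⟩ := h n
  exact (Nat.cast_le.2 hnm).trans (le_iSup₂ (f := fun (n : ℕ) (_ : SyncausalPath r n θ θ') =>
    (n : ℕ∞)) m hm)

/-! ### Properties of the set of runs that both models share -/

/-- The state of an agent is determined by its initial state and by the external inputs and
message deliveries that it has observed. -/
def Determinate (R : Set (Run γ)) : Prop :=
  ∀ r ∈ R, ∀ r' ∈ R, ∀ i t, r.init i = r'.init i →
    (∀ s ≤ t, ∀ e : Event γ, e.observer = i → (∀ j, e ≠ .timer j) →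
      (e ∈ r.env s ↔ e ∈ r'.env s)) →
    r.state t i = r'.state t i

/-- From any time on, it is possible that there are no external inputs and no fast deliveries. -/
def NoForesight (R : Set (Run γ)) : Prop :=
  ∀ r ∈ R, ∀ t d : T, ∃ r' ∈ R,
    (r'.init = r.init ∧ ∀ s ≤ t, r'.env s = r.env s ∧ r'.state s = r.state s) ∧
    (∀ s, t < s → ∀ e, Event.external e ∉ r'.env s) ∧
    (∀ s, t < s → ∀ m : Delivery γ, Event.delivery m ∈ r'.env s →
      IsND (Event.delivery m) s → m.sentAt + d ≤ s)

/-- It is possible that only the ND events in the past of a given agent-time pair take place. -/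
def NoExtrasensoryPerception (R : Set (Run γ)) : Prop :=
  ∀ r ∈ R, ∀ t i, r.PND i t ∈ retainable R r t

/-- The condition on `k` has the same form as that on `j`, so the walk inside the component can be
continued indefinitely. -/
theorem Constraint.exists_edge_of_cycle {α : Type u} {I : Set α} {D : Type} {δ : Constraint I D}
    {j : I} (h : ∃ l, j ≠ l ∧ Relation.ReflTransGen δ.Edge j l ∧ Relation.ReflTransGen δ.Edge l j) :
    ∃ k, δ.Edge j k ∧ ∃ l, k ≠ l ∧ Relation.ReflTransGen δ.Edge k l ∧
      Relation.ReflTransGen δ.Edge l k := by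
  obtain ⟨l, hjl, h1, h2⟩ := h
  rcases h1.cases_head with rfl | ⟨k, hk, hkl⟩
  · exact absurd rfl hjl
  · exact ⟨k, hk, j, hk.1.symm, hkl.trans h2, .single hk⟩

/-- Every point is indistinguishable for `j` from one at the same time at which all ND events so
far are in the past of `j`. -/
theorem exists_indist_past (hU : UnboundedDelivery γ) {R : Set (Run γ)} (hdet : Determinate R)
    (hnes : NoExtrasensoryPerception R) (p : Point R) (j : γ.Agent) :
    ∃ q : Point R, q.2 = p.2 ∧ Indist j p q ∧ q.1.1.ND q.2 ⊆ p.1.1.ND p.2 ∧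
      q.1.1.ND q.2 ⊆ q.1.1.PND j q.2 := by
  obtain ⟨⟨r, hr⟩, t⟩ := p
  obtain ⟨r', hr', ⟨hinit, hsub⟩, hND⟩ := hnes r hr t j
  refine ⟨(⟨r', hr'⟩, t), rfl, ⟨?_, fun _ => rfl⟩, hsub, ?_⟩
  -- What `j` observes up to `t` is in its own past by locality, hence is retained in `r'`.
  · refine hdet r hr r' hr' j t (by rw [hinit]) fun s hs e he hnt => ⟨fun h => ?_, fun h => ?_⟩
    · have : (e, s) ∈ r.PND j t := ⟨h, hU.isND hnt, by subst he; exact .of_le hs⟩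
      rw [← hND] at this
      exact this.1
    · exact (hsub (show (e, s) ∈ r'.ND t from ⟨h, hU.isND hnt, hs⟩)).1
  -- The past must be taken in `r'`: the deliveries on a path of `r` to `(j, t)` are themselves in
  -- the past of `(j, t)`, so the path survives.
  · intro f hf
    have hf' : f ∈ r.PND j t := hND ▸ hf
    obtain ⟨n, hn⟩ := hf'.2.2
    refine ⟨hf.1, hf.2.1, n, hn.transfer hU fun d s hd hs => ?_⟩
    have : (Event.delivery d, s) ∈ r.PND j t := ⟨hd, hU.isND_delivery d s, hs⟩
    rw [← hND] at this
    exact this.1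

theorem le_of_ofTime_le {T D : Type} [TimeDiff T D] [LinearOrder T] [LinearOrder D]
    [AddCommGroup D] (hmono : StrictMono (TimeDiff.toDiff : T → D)) {t t' : T}
    (h : (Delta.ofTime t' : Delta D) ≤ Delta.ofTime t + 0) : t' ≤ t := by
  rw [add_zero, Delta.ofTime, Delta.ofTime, WithBot.coe_le_coe, WithTop.coe_le_coe] at h
  exact hmono.le_iff_le.1 h

/-! ### Common knowledge forces unbounded paths -/

section Common

variable {D : Type} [TimeDiff T D] [LinearOrder D] [AddCommGroup D] {R : Set (Run γ)}
  {I : Set γ.Agent} {δ : Constraint I D}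

/-- One unfolding of the fixed point; a finite `ε` is what makes the waiting time for `j` bounded.
-/
theorem exists_knows_of_mem_deltaCommonKnowledge {i j : I} (hij : δ.Edge i j)
    (ψ : Set (Point R)) :
    ∃ ε : D, ∀ p ∈ deltaCommonKnowledge δ ψ i, ∃ t' : T,
      Delta.ofTime t' ≤ Delta.ofTime p.2 + ((ε : WithTop D) : Delta D) ∧
      (p.1, t') ∈ knows j.1 (ψ ∩ deltaCommonKnowledge δ ψ j) := by
  obtain ⟨h, hδ⟩ := hij
  have hstep : ∀ p ∈ deltaCommonKnowledge δ ψ i, ∃ t' : T,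
      Delta.ofTime t' ≤ Delta.ofTime p.2 + δ i j h ∧
      (p.1, t') ∈ knows j.1 (ψ ∩ deltaCommonKnowledge δ ψ j) := by
    intro p hp
    rw [deltaCommonKnowledge, ← OrderHom.map_gfp] at hp
    exact Set.mem_iInter₂.1 hp j h
  generalize δ i j h = ε at hstep hδ
  induction ε using WithBot.recBotCoe with
  | bot =>
    -- No time is at most `-∞`, so there is no such `p`, and `0` is arbitrary.
    refine ⟨0, fun p hp => ?_⟩
    obtain ⟨t', ht', -⟩ := hstep p hp
    rw [WithBot.add_bot] at ht'
    exact absurd ht' (WithBot.not_coe_le_bot _)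
  | coe ε =>
    induction ε using WithTop.recTopCoe with
    | top => exact absurd rfl hδ
    | coe ε => exact ⟨ε, hstep⟩

/-- If `j` knows that `e` has happened and that `δ`-common knowledge holds, and if the past of `j`
contains all ND events, then there are syncausal paths with arbitrarily many deliveries. -/
theorem exists_long_path [CanonicallyOrderedAdd T] (hU : UnboundedDelivery γ)
    (hdet : Determinate R) (hnf : NoForesight R) (hnes : NoExtrasensoryPerception R)
    (hmono : StrictMono (TimeDiff.toDiff : T → D))
    (hlate : ∀ (t : T) (ε : D), ∃ d : T, ∀ t' : T,
      Delta.ofTime t' ≤ Delta.ofTime t + ((ε : WithTop D) : Delta D) → t' < d)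
    {e : Event γ} (he : ∀ i, e ≠ .timer i)
    (hunique : ∀ r ∈ R, ∀ s s', e ∈ r.env s → e ∈ r.env s' → s = s')
    (n : ℕ) (j : I) (p : Point R)
    (hj : ∃ l, j ≠ l ∧ Relation.ReflTransGen δ.Edge j l ∧ Relation.ReflTransGen δ.Edge l j)
    (hp : p ∈ knows j.1 (noLaterThan (0 : Delta D) (occurring R e) ∩
      deltaCommonKnowledge δ (noLaterThan (0 : Delta D) (occurring R e)) j))
    (hpast : p.1.1.ND p.2 ⊆ p.1.1.PND j.1 p.2) (s : T) (hs : e ∈ p.1.1.env s) :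
    ∃ m, n ≤ m ∧ SyncausalPath p.1.1 m (e.observer, s) (j.1, p.2) := by
  -- The inductive hypothesis is applied to another agent at a point of another run.
  induction n generalizing j p s with
  | zero =>
    obtain ⟨⟨t', ht', hocc⟩, -⟩ := hp p ⟨rfl, fun _ => rfl⟩
    obtain rfl := hunique _ p.1.2 s t' hs hocc
    obtain ⟨-, -, m, hm⟩ := hpast (show (e, s) ∈ p.1.1.ND p.2 from
      ⟨hs, hU.isND he, le_of_ofTime_le hmono ht'⟩)
    exact ⟨m, Nat.zero_le _, hm⟩
  | succ n ih =>
    obtain ⟨⟨r, hr⟩, t⟩ := p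
    obtain ⟨k, hjk, hk⟩ := Constraint.exists_edge_of_cycle hj
    have key : ∃ (t₂ : T) (r₁ : Run γ) (hr₁ : r₁ ∈ R), r₁.ND t₂ ⊆ r.ND t ∧
        ((⟨r₁, hr₁⟩, t₂) : Point R) ∈ knows k.1 (noLaterThan (0 : Delta D) (occurring R e) ∩
          deltaCommonKnowledge δ (noLaterThan (0 : Delta D) (occurring R e)) k) := by
      obtain ⟨ε, hε⟩ := exists_knows_of_mem_deltaCommonKnowledge (R := R) hjk
        (noLaterThan (0 : Delta D) (occurring R e))
      -- `d` exceeds every time allowed for `k`. A delivery of `r₁` after `t` takes place no earlier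
      -- than `d`, hence after `t₂`.
      obtain ⟨d, hd⟩ := hlate t ε
      obtain ⟨r₁, hr₁, ⟨-, hagree⟩, hext, hdel⟩ := hnf r hr t d
      -- The state of `j` at `t` is unchanged, so what `j` knows in `r` holds in `r₁`.
      have hC := (hp (⟨r₁, hr₁⟩, t) ⟨by rw [(hagree t le_rfl).2], fun _ => rfl⟩).2
      obtain ⟨t₂, ht₂, hk₁⟩ := hε _ hC
      refine ⟨t₂, r₁, hr₁, ?_, hk₁⟩
      rintro ⟨f, u⟩ ⟨hf, hfnd, hu⟩
      rcases le_or_gt u t with hut | hut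
      · exact ⟨(hagree u hut).1 ▸ hf, hfnd, hut⟩
      · cases f with
        | external x => exact absurd hf (hext u hut x)
        | delivery m =>
          exact absurd ((le_add_self.trans (hdel u hut m hf hfnd)).trans hu) (hd t₂ ht₂).not_ge
        | timer i => exact absurd rfl (hfnd.ne_timer i)
    obtain ⟨t₂, r₁, hr₁, hsub, hk₁⟩ := key
    obtain ⟨⟨⟨r₂, hr₂⟩, t₃⟩, heq, hind, hsub₂, hpast₂⟩ :=
      exists_indist_past hU hdet hnes (⟨r₁, hr₁⟩, t₂) k.1
    obtain rfl : t₂ = t₃ := heq.symm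
    have hk₂ : ((⟨r₂, hr₂⟩, t₂) : Point R) ∈
        knows k.1 (noLaterThan (0 : Delta D) (occurring R e) ∩
          deltaCommonKnowledge δ (noLaterThan (0 : Delta D) (occurring R e)) k) :=
      fun q hq => hk₁ q ⟨hind.1.trans hq.1, hq.2⟩
    have hsub₃ : r₂.ND t₂ ⊆ r.ND t := hsub₂.trans hsub
    obtain ⟨⟨s', hs', hocc⟩, -⟩ := hk₂ _ ⟨rfl, fun _ => rfl⟩
    have hes : (e, s') ∈ r.ND t := hsub₃ ⟨hocc, hU.isND he, le_of_ofTime_le hmono hs'⟩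
    obtain rfl := hunique r hr s s' hs hes.1
    obtain ⟨m, hnm, hm⟩ := ih k (⟨r₂, hr₂⟩, t₂) hk hk₂ hpast₂ s hocc
    -- `f` is the last ND event on the path. It is observed by `k` and occurs in `r`, so `hpast`
    -- connects it to `j`.
    obtain ⟨f, hf, hfk, -, hpath⟩ := hm.exists_last_event hU ⟨_, hes, rfl, rfl⟩
      fun d u hu hd => hsub₃ ⟨hd, hU.isND_delivery d u, hu⟩
    obtain ⟨-, -, l, hl⟩ := hpast hf
    rw [hfk] at hl
    have hl0 : l ≠ 0 := fun h0 =>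
      hjk.1 (Subtype.ext (hl.fst_eq_of_zero hU h0).symm)
    exact ⟨m + l, by omega, hpath.trans hl⟩

/-- If `G_δ` has a strongly connected component with more than one vertex, then there is never
`δ`-common knowledge that an ND event has happened. -/
theorem deltaCommonKnowledge_eq_empty [CanonicallyOrderedAdd T] (hU : UnboundedDelivery γ)
    {runs : Protocol γ → Set (Run γ)} (hB : BoundedSyncausalPath runs) {P : Protocol γ}
    (hdet : Determinate (runs P)) (hnf : NoForesight (runs P))
    (hnes : NoExtrasensoryPerception (runs P))
    (hmono : StrictMono (TimeDiff.toDiff : T → D))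
    (hlate : ∀ (t : T) (ε : D), ∃ d : T, ∀ t' : T,
      Delta.ofTime t' ≤ Delta.ofTime t + ((ε : WithTop D) : Delta D) → t' < d)
    {e : Event γ} (he : ∀ i, e ≠ .timer i)
    (hunique : ∀ r ∈ runs P, ∀ s s', e ∈ r.env s → e ∈ r.env s' → s = s')
    (hδ : δ.HasNontrivialSCC) :
    deltaCommonKnowledge δ (noLaterThan (0 : Delta D) (occurring (runs P) e)) = fun _ => ∅ := by
  set ψ := noLaterThan (0 : Delta D) (occurring (runs P) e) with hψ
  have hempty : ∀ j : I, (∃ l, j ≠ l ∧ Relation.ReflTransGen δ.Edge j l ∧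
      Relation.ReflTransGen δ.Edge l j) →
      ∀ p : Point (runs P), p ∉ knows j.1 (ψ ∩ deltaCommonKnowledge δ ψ j) := by
    intro j hj p hp
    obtain ⟨q, -, hind, -, hpast⟩ := exists_indist_past hU hdet hnes p j.1
    have hq : q ∈ knows j.1 (ψ ∩ deltaCommonKnowledge δ ψ j) :=
      fun q' hq' => hp q' ⟨hind.1.trans hq'.1, fun h => (hind.2 h).trans (hq'.2 h)⟩
    obtain ⟨⟨s, -, hs⟩, -⟩ := hq q ⟨rfl, fun _ => rfl⟩
    exact not_syncausal_of_unbounded_paths hB q.1.2 fun n =>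
      exists_long_path hU hdet hnf hnes hmono hlate he hunique n j q hj hq hpast s hs
  -- The intersection runs over all `j ≠ i`, and even `δ = ∞` requires `j` to know at some time. So
  -- one agent that never knows empties all other components, also outside its strongly connected
  -- component.
  have hstep : ∀ i j : I, i ≠ j → (∀ p : Point (runs P),
      p ∉ knows j.1 (ψ ∩ deltaCommonKnowledge δ ψ j)) → deltaCommonKnowledge δ ψ i = ∅ := by
    intro i j h hj
    refine Set.eq_empty_of_forall_notMem fun p hp => ?_
    rw [deltaCommonKnowledge, ← OrderHom.map_gfp] at hp
    obtain ⟨t', -, hk⟩ := Set.mem_iInter₂.1 hp j h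
    exact hj _ hk
  obtain ⟨i, j, hij, h1, h2⟩ := hδ
  funext k
  -- At least one of the two agents `i`, `j` on the cycle differs from `k`.
  rcases eq_or_ne k i with rfl | hk
  · exact hstep k j hij (hempty j ⟨k, hij.symm, h2, h1⟩)
  · exact hstep k i hk (hempty i ⟨j, hij, h1, h2⟩)

end Common

end Generic

/-! ### Existence of runs in the discrete-time model -/

section Discrete

variable {γ : Context.{u} ℕ}

/-- The histories `r` and `r'` agree before time `n`. -/
def Run.AgreeBelow (n : ℕ) (r r' : Run γ) : Prop :=
  r.init = r'.init ∧ ∀ s < n, r.env s = r'.env s ∧ r.state s = r'.state s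

/-- A causal operator on histories has a fixed point. -/
theorem Run.exists_fixed_point {Φ : Run γ → Run γ} (r₀ : Run γ)
    (hinit : ∀ r, (Φ r).init = r₀.init)
    (hΦ : ∀ n r r', AgreeBelow n r r' → AgreeBelow (n + 1) (Φ r) (Φ r')) :
    ∃ r, Φ r = r := by
  have hF0 : ∀ n, (Φ^[n] r₀).init = r₀.init := by
    intro n
    cases n with
    | zero => rfl
    | succ n => rw [Function.iterate_succ_apply', hinit]
  -- After `n` iterations, everything before time `n` is final; the fixed point is read off
  -- diagonally.
  have hF : ∀ n m, n ≤ m → AgreeBelow n (Φ^[n] r₀) (Φ^[m] r₀) := by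
    intro n
    induction n with
    | zero => exact fun m _ => ⟨(hF0 m).symm, fun s hs => absurd hs s.not_lt_zero⟩
    | succ n ih =>
      intro m hm
      obtain ⟨m, rfl⟩ : ∃ k, m = k + 1 := ⟨m - 1, by omega⟩
      rw [Function.iterate_succ_apply', Function.iterate_succ_apply']
      exact hΦ _ _ _ (ih m (by omega))
  let r : Run γ := ⟨r₀.init, fun s => (Φ^[s + 1] r₀).env s, fun s => (Φ^[s + 1] r₀).state s⟩
  have hr : ∀ n, AgreeBelow n r (Φ^[n] r₀) :=
    fun n => ⟨(hF0 n).symm, fun s hs => (hF (s + 1) n hs).2 s s.lt_succ_self⟩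
  have hΦr : ∀ s, (Φ r).env s = r.env s ∧ (Φ r).state s = r.state s := by
    intro s
    have h := (hΦ s _ _ (hr s)).2 s s.lt_succ_self
    rwa [← Function.iterate_succ_apply' Φ] at h
  refine ⟨r, ?_⟩
  have h1 : (Φ r).init = r.init := hinit r
  have h2 : (Φ r).env = r.env := funext fun s => (hΦr s).1
  have h3 : (Φ r).state = r.state := funext fun s => (hΦr s).2
  generalize Φ r = q at h1 h2 h3
  cases q
  subst h1 h2 h3
  rfl

/-! ### Dependence of states and actions on the observed past -/

theorem Run.discreteBefore_congr {n : ℕ} {r r' : Run γ} (h : AgreeBelow n r r')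
    (i : γ.Agent) {s : ℕ} (hs : s ≤ n) : r.discreteBefore i s = r'.discreteBefore i s := by
  cases s with
  | zero => exact congrFun h.1 i
  | succ s => exact congrFun (h.2 s hs).2 i

theorem Run.observation_congr {r r' : Run γ} {i : γ.Agent} {s : ℕ}
    (h : ∀ e : Event γ, e.observer = i → (e ∈ r.env s ↔ e ∈ r'.env s)) :
    r.observation i s = r'.observation i s := by
  unfold Run.observation
  congr 1
  · ext x
    exact h _ x.2
  · ext x
    refine exists_congr fun d => ⟨fun hd => ?_, fun hd => ?_⟩
    · exact ⟨(h (.delivery d) hd.2.1).1 hd.1, hd.2⟩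
    · exact ⟨(h (.delivery d) hd.2.1).2 hd.1, hd.2⟩
  · exact propext (h _ rfl)

theorem Run.discreteAction_congr_of_agreeBelow {n : ℕ} {r r' : Run γ} (h : AgreeBelow n r r')
    (P : Protocol γ) (i : γ.Agent) {s : ℕ} (hs : s < n) :
    r.discreteAction P i s = r'.discreteAction P i s := by
  rw [discreteAction, discreteAction, discreteBefore_congr h i hs.le,
    observation_congr (r := r) (r' := r') fun e _ => by rw [(h.2 s hs).1]]

/-- What an agent does depends only on its initial state and on what it has observed. -/
theorem Run.discreteAction_congr {P : Protocol γ} {r r' : Run γ} {i : γ.Agent}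
    (hr : ∀ t, r.state t i = (r.discreteAction P i t).newState)
    (hr' : ∀ t, r'.state t i = (r'.discreteAction P i t).newState)
    (hinit : r.init i = r'.init i) (t : ℕ)
    (h : ∀ s ≤ t, ∀ e : Event γ, e.observer = i → (e ∈ r.env s ↔ e ∈ r'.env s)) :
    r.discreteAction P i t = r'.discreteAction P i t := by
  induction t with
  | zero =>
    rw [discreteAction, discreteAction, observation_congr (h 0 le_rfl)]
    exact congrArg (fun s => P.act i s _ 0) hinit
  | succ t ih =>
    rw [discreteAction, discreteAction, observation_congr (h _ le_rfl)]
    refine congrArg (fun s => P.act i s _ (t + 1)) ?_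
    change r.state t i = r'.state t i
    rw [hr, hr', ih fun s hs => h s (hs.trans t.le_succ)]

theorem determinate_discreteRuns (P : Protocol γ) : Determinate (discreteRuns P) := by
  intro r hr r' hr' i t hinit h
  rw [hr.state_eq, hr'.state_eq, Run.discreteAction_congr (hr.state_eq i) (hr'.state_eq i) hinit t]
  intro s hs e he
  by_cases hnt : ∀ j, e ≠ .timer j
  · exact h s hs e he hnt
  · push Not at hnt
    obtain ⟨j, rfl⟩ := hnt
    exact iff_of_false (hr.no_timer j s) (hr'.no_timer j s)

/-! ### Runs with prescribed events and delayed deliveries -/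

/-- The environment up to time `t` is given by `E`; afterwards, all messages not yet delivered are
delivered, each with a delay of more than `d`. -/
def delayedEnv (P : Protocol γ) (E : Set (Event γ × ℕ)) (t d : ℕ) (r : Run γ) (s : ℕ) :
    Set (Event γ) :=
  {e | (s ≤ t ∧ (e, s) ∈ E) ∨ ∃ m : Delivery γ, e = .delivery m ∧ (∀ s', (e, s') ∉ E) ∧
    s = max (t + 1) (m.sentAt + 1 + d) ∧
    (m.msg, ⟨m.recipient, m.nbr⟩) ∈ (r.discreteAction P m.sender m.sentAt).send}

/-- The next approximation to the run of `P` with environment `delayedEnv`. -/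
def delayedStep (P : Protocol γ) (E : Set (Event γ × ℕ)) (t d : ℕ) (ini : ∀ i, γ.State i)
    (r : Run γ) : Run γ where
  init := ini
  env := delayedEnv P E t d r
  -- The state before `s` comes from the given history and the observation from the new environment,
  -- so each application settles one more time.
  state s i := (P.act i ((⟨ini, r.env, r.state⟩ : Run γ).discreteBefore i s)
    ((⟨ini, delayedEnv P E t d r, r.state⟩ : Run γ).observation i s) s).newState

/-- Deliveries added at `s` are of messages sent strictly before `s`, so agreement before `n`
determines the environment at `n` as well. -/
theorem delayedEnv_congr (P : Protocol γ) (E : Set (Event γ × ℕ)) (t d : ℕ) {r r' : Run γ} {n : ℕ}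
    (h : Run.AgreeBelow n r r') {s : ℕ} (hs : s ≤ n) :
    delayedEnv P E t d r s = delayedEnv P E t d r' s := by
  ext e
  refine or_congr_right (exists_congr fun m => and_congr_right fun _ => and_congr_right fun _ =>
    and_congr_right fun hm => ?_)
  rw [Run.discreteAction_congr_of_agreeBelow h P m.sender (by omega : m.sentAt < n)]

/-- There is a history with environment `delayedEnv` in which the agents act according to `P`. -/
theorem exists_delayed_run (P : Protocol γ) (E : Set (Event γ × ℕ)) (t d : ℕ) (r₀ : Run γ) :
    ∃ r : Run γ, r.init = r₀.init ∧ r.env = delayedEnv P E t d r ∧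
      ∀ i s, r.state s i = (r.discreteAction P i s).newState := by
  obtain ⟨r, hr⟩ := Run.exists_fixed_point (Φ := delayedStep P E t d r₀.init) r₀ (fun _ => rfl) <| by
    intro n r r' h
    refine ⟨rfl, fun s hs => ?_⟩
    have henv := delayedEnv_congr P E t d h (Nat.lt_succ_iff.1 hs)
    refine ⟨henv, funext fun i => ?_⟩
    have hb := Run.discreteBefore_congr (r := ⟨r₀.init, r.env, r.state⟩)
      (r' := ⟨r₀.init, r'.env, r'.state⟩) ⟨rfl, h.2⟩ i (Nat.lt_succ_iff.1 hs)
    have ho := Run.observation_congr (r := ⟨r₀.init, delayedEnv P E t d r, r.state⟩)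
      (r' := ⟨r₀.init, delayedEnv P E t d r', r'.state⟩) (i := i) (s := s)
      fun e _ => Set.ext_iff.1 henv e
    change (P.act i _ _ s).newState = (P.act i _ _ s).newState
    rw [hb, ho]
  have h1 : r.init = r₀.init := (congrArg Run.init hr).symm
  have h2 : r.env = delayedEnv P E t d r := (congrArg Run.env hr).symm
  refine ⟨r, h1, h2, fun i s => ?_⟩
  have h3 := congrFun (congrFun (congrArg Run.state hr) s) i
  rw [← h3]
  change (P.act i _ _ s).newState = (P.act i _ _ s).newState
  rw [← h1, ← h2]

/-- A set of ND events of a run that contains the past of each of its deliveries is the set of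
ND events up to `t` in some run with late deliveries thereafter. -/
theorem exists_discreteRun (hU : UnboundedDelivery γ) {P : Protocol γ} {r : Run γ}
    (hr : r ∈ discreteRuns P) (E : Set (Event γ × ℕ)) (t d : ℕ) (hE : E ⊆ r.ND t)
    (hclosed : ∀ (m : Delivery γ) s, (Event.delivery m, s) ∈ E → ∀ s' ≤ m.sentAt,
      ∀ e : Event γ, e.observer = m.sender → e ∈ r.env s' → (e, s') ∈ E) :
    ∃ r' ∈ discreteRuns P, r'.init = r.init ∧ (∀ s ≤ t, r'.env s = {e | (e, s) ∈ E}) ∧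
      (∀ s, t < s → ∀ e, Event.external e ∉ r'.env s) ∧
      (∀ s, t < s → ∀ m : Delivery γ, Event.delivery m ∈ r'.env s → m.sentAt + d ≤ s) := by
  obtain ⟨r', hinit, henv, hstate⟩ := exists_delayed_run P E t d r
  have hlow : ∀ s ≤ t, r'.env s = {e | (e, s) ∈ E} := by
    intro s hs
    ext e
    rw [henv]
    constructor
    · rintro (⟨-, h⟩ | ⟨m, -, -, h, -⟩)
      · exact h
      · omega
    · exact fun h => .inl ⟨hs, h⟩
  have hhigh : ∀ s, t < s → ∀ e ∈ r'.env s, ∃ m : Delivery γ, e = .delivery m ∧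
      s = max (t + 1) (m.sentAt + 1 + d) ∧
      (m.msg, ⟨m.recipient, m.nbr⟩) ∈ (r'.discreteAction P m.sender m.sentAt).send := by
    intro s hs e he
    rw [henv] at he
    obtain ⟨h, -⟩ | ⟨m, h, -, h'⟩ := he
    · omega
    · exact ⟨m, h, h'⟩
  have hext : ∀ s e, Event.external e ∈ r'.env s → (Event.external e, s) ∈ E := by
    intro s e he
    rcases le_or_gt s t with hs | hs
    · rwa [hlow s hs] at he
    · obtain ⟨m, h, -⟩ := hhigh s hs _ he
      cases h
  -- By `hclosed`, the sender of a message delivered in `E` has observed the same in both runs up to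
  -- the sending, so it sends that message in `r'` too.
  have hsent : ∀ (m : Delivery γ) s, (Event.delivery m, s) ∈ E →
      m.sentAt < s ∧ (m.msg, ⟨m.recipient, m.nbr⟩) ∈
        (r'.discreteAction P m.sender m.sentAt).send := by
    intro m s hm
    have hs := hr.laws.only_sent m s (hE hm).1
    obtain ⟨t', hlt, -, ht'⟩ := hr.laws.delivered m hs
    obtain rfl := (ht' s).1 (hE hm).1
    refine ⟨hlt, ?_⟩
    rwa [Run.discreteAction_congr (r := r') (r' := r) (hstate _) (hr.state_eq _)
      (congrFun hinit _)]
    intro u hu e he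
    rw [hlow u (hu.trans (hlt.le.trans (hE hm).2.2))]
    exact ⟨fun h => (hE h).1, hclosed m s hm u hu e he⟩
  refine ⟨r', ⟨fun i => by rw [hinit]; exact hr.init_mem i, hstate, ⟨?_, ?_, ?_⟩, ?_⟩, hinit,
    hlow, ?_, ?_⟩
  · exact fun e s s' hs hs' =>
      hr.laws.external_once e s s' (hE (hext s e hs)).1 (hE (hext s' e hs')).1
  · intro m hm
    have hb : ∀ t' : ℕ, (t' : WithTop ℕ) ≤ m.sentAt + γ.bound m.sender m.recipient :=
      fun t' => (hU.isND_delivery m t').le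
    by_cases hmE : ∃ s, (Event.delivery m, s) ∈ E
    · obtain ⟨s, hs⟩ := hmE
      refine ⟨s, (hsent m s hs).1, hb s, fun u => ⟨fun hu => ?_, ?_⟩⟩
      · rw [henv] at hu
        obtain ⟨-, hu⟩ | ⟨m', -, h, -⟩ := hu
        · exact hr.laws.unique (hU.isND_delivery m s).ne_timer (hE hu).1 (hE hs).1
        · exact absurd hs (h s)
      · rintro rfl
        rw [hlow u (hE hs).2.2]
        exact hs
    · push Not at hmE
      refine ⟨max (t + 1) (m.sentAt + 1 + d), by omega, hb _, fun u => ?_⟩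
      rw [henv]
      constructor
      · rintro (⟨-, h⟩ | ⟨m', h, -, hu, -⟩)
        · exact absurd h (hmE u)
        · cases h
          exact hu
      · exact fun hu => .inr ⟨m, rfl, hmE, hu, hm⟩
  · intro m s hm
    rcases le_or_gt s t with hs | hs
    · rw [hlow s hs] at hm
      exact (hsent m s hm).2
    · obtain ⟨m', h, -, h'⟩ := hhigh s hs _ hm
      cases h
      exact h'
  · intro i s hi
    rcases le_or_gt s t with hs | hs
    · rw [hlow s hs] at hi
      exact (hE hi).2.1
    · obtain ⟨m', h, -⟩ := hhigh s hs _ hi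
      cases h
  · intro s hs e he
    obtain ⟨m', h, -⟩ := hhigh s hs _ he
    cases h
  · intro s hs m hm
    obtain ⟨m', h, h', -⟩ := hhigh s hs _ hm
    cases h
    omega

/-- Without timers all events are ND, so retaining all ND events up to `t` reproduces `r` up to `t`.
-/
theorem noForesight_discreteRuns (hU : UnboundedDelivery γ) (P : Protocol γ) :
    NoForesight (discreteRuns P) := by
  intro r hr t d
  obtain ⟨r', hr', hinit, hlow, hext, hdel⟩ := exists_discreteRun hU hr (r.ND t) t d le_rfl <| by
    intro m s hm s' hs' e _ he
    obtain ⟨t', hlt, -, ht'⟩ := hr.laws.delivered m (hr.laws.only_sent m s hm.1)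
    obtain rfl := (ht' s).1 hm.1
    exact ⟨he, hU.isND (fun i h => hr.no_timer i s' (h ▸ he)), hs'.trans (hlt.le.trans hm.2.2)⟩
  have henv : ∀ s ≤ t, r'.env s = r.env s := by
    intro s hs
    rw [hlow s hs]
    ext e
    exact ⟨fun h => h.1, fun h => ⟨h, hU.isND (fun i h' => hr.no_timer i s (h' ▸ h)), hs⟩⟩
  refine ⟨r', hr', ⟨hinit, fun s hs => ⟨henv s hs, funext fun i => ?_⟩⟩, hext,
    fun s hs m hm _ => hdel s hs m hm⟩
  exact determinate_discreteRuns P r' hr' r hr i s (congrFun hinit i)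
    fun u hu e _ _ => by rw [henv u (hu.trans hs)]

/-- The ND past is closed as required: what a sender has observed by the sending time is in the past
of the delivery. -/
theorem noExtrasensoryPerception_discreteRuns (hU : UnboundedDelivery γ) (P : Protocol γ) :
    NoExtrasensoryPerception (discreteRuns P) := by
  intro r hr t i
  obtain ⟨r', hr', hinit, hlow, -, -⟩ := exists_discreteRun hU hr (r.PND i t) t 0
    (r.PND_subset_ND hU i t) <| by
    intro m s hm s' hs' e he hes
    obtain ⟨t', hlt, -, ht'⟩ := hr.laws.delivered m (hr.laws.only_sent m s hm.1)
    obtain rfl := (ht' s).1 hm.1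
    refine ⟨hes, hU.isND (fun i h => hr.no_timer i s' (h ▸ hes)), ?_⟩
    refine (Syncausal.trans ?_ hm.2.2 : Syncausal r (e.observer, s') (i, t))
    rw [he]
    exact ⟨1, .earlyDelivery m (.locality (.refl _) hs') hm.1 hlt hm.2.1⟩
  have hND : r'.ND t = r.PND i t := by
    ext ⟨e, s⟩
    constructor
    · rintro ⟨he, -, hs⟩
      have he' : e ∈ r'.env s := he
      rwa [hlow s hs] at he'
    · intro h
      have hs := (r.PND_subset_ND hU i t h).2.2
      refine ⟨?_, h.2.1, hs⟩
      change e ∈ r'.env s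
      rw [hlow s hs]
      exact h
  exact ⟨r', hr', ⟨hinit, hND ▸ r.PND_subset_ND hU i t⟩, hND⟩

end Discrete

end TimelyCoordination

/-! ### The theorem in both models of time -/

open TimelyCoordination in
theorem mainTheorem12 :
    (∀ (γ : Context.{u} ℕ) (I : Set γ.Agent) (δ : Constraint I ℤ) (e : Event γ),
      BoundedSyncausalPath (discreteRuns (γ := γ)) →
      UnboundedDelivery γ → (∃ t, IsND e t) → δ.HasNontrivialSCC →
      ∀ P : Protocol γ,
        deltaCommonKnowledge δ (noLaterThan (0 : Delta ℤ) (occurring (discreteRuns P) e)) =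
          fun _ => ∅) ∧
    (∀ (γ : ContinuousContext.{u}) (I : Set γ.Agent) (δ : Constraint I ℝ)
        (e : Event γ.toContext),
      BoundedSyncausalPath γ.runs →
      UnboundedDelivery γ.toContext → (∃ t, IsND e t) → δ.HasNontrivialSCC →
      ∀ P : Protocol γ.toContext,
        deltaCommonKnowledge δ (noLaterThan (0 : Delta ℝ) (occurring (γ.runs P) e)) =
          fun _ => ∅) := by
  refine ⟨fun γ I δ e hB hU ⟨t, ht⟩ hδ P => ?_, fun γ I δ e hB hU ⟨t, ht⟩ hδ P => ?_⟩
  · refine deltaCommonKnowledge_eq_empty hU hB (determinate_discreteRuns P)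
      (noForesight_discreteRuns hU P) (noExtrasensoryPerception_discreteRuns hU P)
      -- As `ε` may be negative, its nonnegative part is used; adding `1` makes the bound strict.
      (fun a b h => Int.ofNat_lt.2 h) (fun t ε => ⟨t + ε.toNat + 1, fun t' h => ?_⟩)
      ht.ne_timer (fun r hr s s' => hr.laws.unique ht.ne_timer) hδ
    have h' : (t' : ℤ) ≤ t + ε := WithTop.coe_le_coe.1 (WithBot.coe_le_coe.1 h)
    omega
  · refine deltaCommonKnowledge_eq_empty hU hB (γ.determinate P) (γ.no_foresight P)
      (γ.no_extrasensory_perception P)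
      (fun a b h => NNReal.coe_lt_coe.2 h) (fun t ε => ⟨t + ε.toNNReal + 1, fun t' h => ?_⟩)
      ht.ne_timer (fun r hr s s' => (γ.isRun P r hr).laws.unique ht.ne_timer) hδ
    have h' : (t' : ℝ) ≤ t + ε := WithTop.coe_le_coe.1 (WithBot.coe_le_coe.1 h)
    rw [← NNReal.coe_lt_coe]
    push_cast
    linarith [Real.le_coe_toNNReal ε]
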